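/- Let $n\ge 1$, let $E_1,\dots,E_n$ and $F$ be Banach spaces over $\mathbb K=\mathbb R$ or $\mathbb C$, and let $q>2$ be a real number. Suppose that each $E_k$ has cotype $q$, that is, there is a constant $C_k\ge 0$ such that for all $m$ and all $x_1,\dots,x_m\in E_k$ $$\Big(\sum_{i=1}^m\|x_i\|^q\Big)^{1/q}\le C_k\Big(\frac1{2^m}\sum_{\varepsilon\in\{-1,1\}^m}\Big\|\sum_{i=1}^m\varepsilon_i x_i\Big\|^2\Big)^{1/2}.$$ For a real number $s\ge 1$ let $\Pi_s^n(E_1,\dots,E_n;F)$ be the set of all multiple $s$-summing maps, i.e. of all continuous $n$-linear maps $A:E_1\times\cdots\times E_n\to F$ for which there is a constant $C\ge 0$ such that $$\Big(\sum_{j_1=1}^{m_1}\cdots\sum_{j_n=1}^{m_n}\big\|A(x^{(1)}_{j_1},\dots,x^{(n)}_{j_n})\big\|^s\Big)^{1/s}\le C\prod_{k=1}^n\ \sup_{\varphi\in E_k',\,\|\varphi\|\le 1}\Big(\sum_{j=1}^{m_k}|\varphi(x^{(k)}_j)|^s\Big)^{1/s}$$ for all $m_1,\dots,m_n\in\mathbb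 N$ and all $x^{(k)}_j\in E_k$ ($1\le j\le m_k$, $1\le k\le n$). Then $$\Pi_s^n(E_1,\dots,E_n;F)\subset\Pi_1^n(E_1,\dots,E_n;F)\qquad\text{for every } 1\le s<\frac{q}{q-1}.$$ -/

import Mathlib

/-- The (Rademacher) cotype `q` of a normed space `E`: for some constant `C` and all finite families
`x₁, …, x_m` in `E`,
`(∑ ‖xᵢ‖ ^ q) ^ (1 / q) ≤ C * (average over all signs ε of ‖∑ εᵢ xᵢ‖ ^ 2) ^ (1 / 2)`. -/
def HasCotype (E : Type*) [NormedAddCommGroup E] (q : ℝ) : Prop :=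
  ∃ C : ℝ, 0 ≤ C ∧ ∀ (m : ℕ) (x : Fin m → E),
    (∑ i, ‖x i‖ ^ q) ^ (1 / q) ≤
      C * ((∑ ε : Fin m → ℤˣ, ‖∑ i, ε i • x i‖ ^ (2 : ℝ)) / 2 ^ m) ^ (1 / (2 : ℝ))

/-- The weak `p`-norm `‖(x_j)‖_{w,p}` of a finite family in `E`: the supremum, over the closed unit
ball of the dual of `E`, of `(∑ |φ (x_j)| ^ p) ^ (1 / p)`. -/
noncomputable def weakNorm (𝕜 : Type*) {E : Type*} [RCLike 𝕜] [NormedAddCommGroup E]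
    [NormedSpace 𝕜 E] (p : ℝ) {m : ℕ} (x : Fin m → E) : ℝ :=
  ⨆ φ : {φ : StrongDual 𝕜 E // ‖φ‖ ≤ 1}, (∑ j, ‖φ.1 (x j)‖ ^ p) ^ (1 / p)

/-- The supremum in `weakNorm` is taken over a bounded set of reals. -/
theorem weakNorm_bddAbove (𝕜 : Type*) {E : Type*} [RCLike 𝕜] [NormedAddCommGroup E]
    [NormedSpace 𝕜 E] {p : ℝ} (hp : 1 ≤ p) {m : ℕ} (x : Fin m → E) :
    BddAbove (Set.range fun φ : {φ : StrongDual 𝕜 E // ‖φ‖ ≤ 1} =>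
      (∑ j, ‖φ.1 (x j)‖ ^ p) ^ (1 / p)) := by
  refine ⟨(∑ j, ‖x j‖ ^ p) ^ (1 / p), ?_⟩
  rintro _ ⟨φ, rfl⟩
  have h : ∀ j, ‖φ.1 (x j)‖ ≤ ‖x j‖ := fun j => by
    simpa using φ.1.le_of_opNorm_le φ.2 (x j)
  have hp0 : 0 ≤ p := by linarith
  refine Real.rpow_le_rpow (by positivity) ?_ (by positivity)
  exact Finset.sum_le_sum fun j _ => Real.rpow_le_rpow (norm_nonneg _) (h j) hp0

/-- `A` is multiple `(q; p₁, …, pₙ)`-summing (considered for `1 ≤ p_k ≤ q`). -/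
def IsMultipleSumming {𝕜 : Type*} [RCLike 𝕜] {n : ℕ} {E : Fin n → Type*} {F : Type*}
    [∀ k, NormedAddCommGroup (E k)] [∀ k, NormedSpace 𝕜 (E k)]
    [NormedAddCommGroup F] [NormedSpace 𝕜 F]
    (q : ℝ) (p : Fin n → ℝ) (A : ContinuousMultilinearMap 𝕜 E F) : Prop :=
  ∃ C : ℝ, 0 ≤ C ∧ ∀ (m : Fin n → ℕ) (x : ∀ k, Fin (m k) → E k),
    (∑ j : ∀ k, Fin (m k), ‖A fun k => x k (j k)‖ ^ q) ^ (1 / q) ≤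
      C * ∏ k, weakNorm 𝕜 (p k) (x k)

/-- The class `Π_s^n(E₁, …, Eₙ; F)` of all multiple `s`-summing (that is, multiple
`(s; s, …, s)`-summing) continuous `n`-linear maps. -/
def multipleSumming (𝕜 : Type*) [RCLike 𝕜] {n : ℕ} (E : Fin n → Type*) (F : Type*)
    [∀ k, NormedAddCommGroup (E k)] [∀ k, NormedSpace 𝕜 (E k)]
    [NormedAddCommGroup F] [NormedSpace 𝕜 F] (s : ℝ) :
    Set (ContinuousMultilinearMap 𝕜 E F) :=
  {A | IsMultipleSumming s (fun _ => s) A}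

open Filter Topology

/-! Every finite family in a cotype `q` space splits as `x j = α j • y j`, with `α` in the unit ball
of `ℓ_r`, `1/r + 1/s = 1`, and the weak `s`-norm of `y` controlled by the weak `1`-norm of `x`.
Given this in each variable, Hölder turns the `s`-estimate for `y` into the `1`-estimate for `x`;
the condition `s < q / (q - 1)` says exactly that `q < r`.

For the splitting, let `u : ℓ_∞^m → E` send `e_j` to `x j`. Cotype makes `u` `(q, 1)`-summing, so
Pisier's theorem (`exists_pisier_weights`) gives weights `w` of mass at most one with `‖u a‖ ^ q ≲ ∑
w |a|` on the unit ball. This is a Lorentz `L_{q,1}(w)` bound, and for `r > q` it yields an `L_r(w)`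
bound (`norm_le_of_weights`). Put `α = w ^ (1/r)`; by duality the `L_r(w)` bound is the weak
`s`-bound on `x / α`. -/

/-! ### Pisier domination on `ℓ_∞^m` -/

theorem exists_weights_of_family {𝕜 E ι : Type*} [RCLike 𝕜] [NormedAddCommGroup E]
    [NormedSpace 𝕜 E] [Fintype ι] (u : (ι → 𝕜) →ₗ[𝕜] E) {q B : ℝ} (hq : 1 ≤ q) (hB : 0 ≤ B)
    (h : ∀ (n : ℕ) (z : Fin n → ι → 𝕜), (∀ t, ∑ i, ‖z i t‖ ≤ 1) → ∑ i, ‖u (z i)‖ ^ q ≤ B ^ q)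
    {n : ℕ} (z : Fin n → ι → 𝕜) (hz : ∀ t, ∑ i, ‖z i t‖ ≤ 1) :
    ∃ l : ι → ℝ, (∀ t, |l t| ≤ B) ∧ ∑ t, l t = (∑ i, ‖u (z i)‖ ^ q) ^ (1 / q) ∧
      ∀ a : ι → 𝕜, (∀ t, ‖a t‖ ≤ 1) →
        ‖u a‖ ^ q + (max 0 (∑ t, (1 - ‖a t‖) * l t)) ^ q ≤ B ^ q := by
  classical
  have hq0 : 0 < q := by linarith
  have : Fact (1 ≤ ENNReal.ofReal q) := ⟨by simpa using ENNReal.ofReal_le_ofReal hq⟩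
  have hqr : (ENNReal.ofReal q).toReal = q := ENNReal.toReal_ofReal hq0.le
  have hV : ∀ v : PiLp (ENNReal.ofReal q) (fun _ : Fin n => E),
      ‖v‖ = (∑ i, ‖v i‖ ^ q) ^ (1 / q) := fun v => by
    rw [PiLp.norm_eq_sum (by rw [hqr]; exact hq0), hqr]
  let V : (ι → ℝ) → PiLp (ENNReal.ofReal q) (fun _ : Fin n => E) := fun f =>
    WithLp.toLp _ fun i => u fun t => (f t : 𝕜) * z i t
  have hVsum : ∀ f, V f = ∑ t, (f t : 𝕜) • V (Pi.single t 1) := fun f => by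
    ext i
    simp only [V, WithLp.ofLp_sum, WithLp.ofLp_smul, Finset.sum_apply, Pi.smul_apply,
      ← map_smul, ← map_sum]
    congr 1
    ext t
    simp [Finset.sum_apply, Pi.single_apply, RCLike.real_smul_eq_coe_mul]
  have hVq : ∀ f, ‖V f‖ ^ q = ∑ i, ‖u fun t => (f t : 𝕜) * z i t‖ ^ q := fun f => by
    rw [hV, ← Real.rpow_mul (by positivity), one_div_mul_cancel hq0.ne', Real.rpow_one]
  -- The weights come from a functional on `ℓ_q^n(E)` norming `(u (z i))_i`, evaluated on the
  -- coordinate pieces of that vector.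
  obtain ⟨φ, hφ, hφV⟩ := exists_dual_vector'' 𝕜 (V 1)
  have hφle : ∀ v, |RCLike.re (φ v)| ≤ ‖v‖ := fun v =>
    (RCLike.abs_re_le_norm _).trans (by simpa using φ.le_of_opNorm_le hφ v)
  have hl : ∀ f : ι → ℝ, ∑ t, f t * RCLike.re (φ (V (Pi.single t 1))) = RCLike.re (φ (V f)) :=
    fun f => by
      rw [hVsum f]
      simp
  refine ⟨fun t => RCLike.re (φ (V (Pi.single t 1))), fun t => ?_, ?_, fun a ha => ?_⟩
  · refine (hφle _).trans ((Real.rpow_le_rpow_iff (norm_nonneg _) hB hq0).1 ?_)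
    rw [hVq]
    refine h n _ fun s => (Finset.sum_le_sum fun i _ => ?_).trans (hz s)
    rw [norm_mul]
    refine mul_le_of_le_one_left (norm_nonneg _) ?_
    by_cases hst : s = t
    · subst hst; simp
    · simp [hst]
  · have := hl 1
    simp only [Pi.one_apply, one_mul] at this
    rw [this, hφV]
    simp [hV, V]
  · have h1 : max 0 (∑ t, (1 - ‖a t‖) * RCLike.re (φ (V (Pi.single t 1)))) ≤
        ‖V fun t => 1 - ‖a t‖‖ := by
      rw [hl]
      exact max_le (norm_nonneg _) ((le_abs_self _).trans (hφle _))
    have h2 := Real.rpow_le_rpow (le_max_left _ _) h1 hq0.le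
    rw [hVq] at h2
    -- Adjoining `a` and damping `z` by `1 - |a|` keeps the family admissible, since `|a| + (1 -
    -- |a|) ∑ |z i| ≤ 1`.
    have h3 := h (n + 1) (Fin.cons a fun i t => ((1 - ‖a t‖ : ℝ) : 𝕜) * z i t) fun t => by
      rw [Fin.sum_univ_succ]
      simp only [Fin.cons_zero, Fin.cons_succ, norm_mul, RCLike.norm_ofReal, ← Finset.mul_sum]
      rw [abs_of_nonneg (by linarith [ha t])]
      nlinarith [ha t, hz t]
    rw [Fin.sum_univ_succ] at h3
    simp only [Fin.cons_zero, Fin.cons_succ] at h3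
    linarith

/-- A finite-dimensional form of Pisier's domination theorem for `(q, 1)`-summing operators on
spaces of continuous functions. -/
theorem exists_pisier_weights {𝕜 E ι : Type*} [RCLike 𝕜] [NormedAddCommGroup E]
    [NormedSpace 𝕜 E] [Fintype ι] (u : (ι → 𝕜) →ₗ[𝕜] E) {q B : ℝ} (hq : 1 ≤ q)
    (h : ∀ (n : ℕ) (z : Fin n → ι → 𝕜), (∀ t, ∑ i, ‖z i t‖ ≤ 1) → ∑ i, ‖u (z i)‖ ^ q ≤ B ^ q) :
    ∃ w : ι → ℝ, (∀ t, 0 ≤ w t) ∧ ∑ t, w t ≤ 1 ∧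
      ∀ a : ι → 𝕜, (∀ t, ‖a t‖ ≤ 1) → ‖u a‖ ^ q ≤ q * B ^ q * ∑ t, w t * ‖a t‖ := by
  classical
  have hq0 : 0 < q := by linarith
  let T : Set ℝ := {c | ∃ (n : ℕ) (z : Fin n → ι → 𝕜), (∀ t, ∑ i, ‖z i t‖ ≤ 1) ∧
    c = (∑ i, ‖u (z i)‖ ^ q) ^ (1 / q)}
  have hTb : BddAbove T := by
    refine ⟨(B ^ q) ^ (1 / q), ?_⟩
    rintro _ ⟨n, z, hz, rfl⟩
    exact Real.rpow_le_rpow (by positivity) (h n z hz) (by positivity)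
  have h0T : (0 : ℝ) ∈ T := ⟨0, Fin.elim0, by simp, by simp [hq0.ne']⟩
  obtain ⟨c, -, hc, hcT⟩ := exists_seq_tendsto_sSup ⟨0, h0T⟩ hTb
  -- The optimal constant replaces `B`: the limiting weights must have total mass equal to the
  -- constant bounding the sums.
  set C := sSup T with hC
  have hC0 : 0 ≤ C := le_csSup hTb h0T
  have hpow : ∀ x : ℝ, 0 ≤ x → (x ^ (1 / q)) ^ q = x := fun x hx => by
    rw [← Real.rpow_mul hx, one_div_mul_cancel hq0.ne', Real.rpow_one]
  have hCh : ∀ (n : ℕ) (z : Fin n → ι → 𝕜), (∀ t, ∑ i, ‖z i t‖ ≤ 1) →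
      ∑ i, ‖u (z i)‖ ^ q ≤ C ^ q := fun n z hz => by
    rw [← hpow (∑ i, ‖u (z i)‖ ^ q) (by positivity)]
    exact Real.rpow_le_rpow (by positivity) (le_csSup hTb ⟨n, z, hz, rfl⟩) hq0.le
  have hCB : C ^ q ≤ B ^ q := by
    have hBq : 0 ≤ B ^ q := by simpa using h 0 Fin.elim0 (by simp)
    rw [← hpow _ hBq]
    refine Real.rpow_le_rpow hC0 (csSup_le ⟨0, h0T⟩ ?_) hq0.le
    rintro _ ⟨n, z, hz, rfl⟩
    exact Real.rpow_le_rpow (by positivity) (h n z hz) (by positivity)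
  choose n z hz hcz using hcT
  choose l hlb hls hla using fun k => exists_weights_of_family u hq hC0 hCh (z k) (hz k)
  -- The supremum need not be attained, so weights of nearly optimal families are passed to a limit
  -- by compactness.
  obtain ⟨L, -, ψ, hψ, hL⟩ := tendsto_subseq_of_bounded (x := l)
    (Metric.isBounded_closedBall (x := (0 : ι → ℝ)) (r := C)) fun k => by
      rw [mem_closedBall_zero_iff, pi_norm_le_iff_of_nonneg hC0]
      exact hlb k
  rw [tendsto_pi_nhds] at hL
  have hLs : ∑ t, L t = C := by
    refine tendsto_nhds_unique (tendsto_finsetSum _ fun t _ => hL t) ?_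
    simp only [Function.comp_apply, hls, ← hcz]
    exact hc.comp hψ.tendsto_atTop
  have hLa : ∀ a : ι → 𝕜, (∀ t, ‖a t‖ ≤ 1) →
      ‖u a‖ ^ q + (max 0 (∑ t, (1 - ‖a t‖) * L t)) ^ q ≤ C ^ q := fun a ha => by
    refine le_of_tendsto (tendsto_const_nhds.add (Tendsto.rpow_const
      (tendsto_const_nhds.max (tendsto_finsetSum _ fun t _ => (hL t).const_mul (1 - ‖a t‖)))
      (Or.inr hq0.le))) (Eventually.of_forall fun k => hla (ψ k) a ha)
  -- Testing with `a = e_t` gives `C - L t ≤ C`.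
  have hL0 : ∀ t, 0 ≤ L t := fun t => by
    have h1 := hLa (Pi.single t 1) fun s => by
      by_cases hst : s = t
      · subst hst; simp
      · simp [hst]
    have h2 : ∑ s, (1 - ‖(Pi.single t (1 : 𝕜) : ι → 𝕜) s‖) * L s = C - L t := by
      have : ∀ s, (1 - ‖(Pi.single t (1 : 𝕜) : ι → 𝕜) s‖) * L s = L s - if s = t then L s else 0 :=
        fun s => by
          by_cases hst : s = t
          · subst hst; simp
          · simp [hst]
      simp [this, hLs]
    rw [h2] at h1
    have h3 : max 0 (C - L t) ≤ C := by
      rw [← Real.rpow_le_rpow_iff (le_max_left _ _) hC0 hq0]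
      linarith [Real.rpow_nonneg (norm_nonneg (u (Pi.single t 1))) q]
    linarith [le_max_right 0 (C - L t)]
  refine ⟨fun t => L t / C, fun t => div_nonneg (hL0 t) hC0, ?_, fun a ha => ?_⟩
  · rw [← Finset.sum_div, hLs]
    exact div_self_le_one C
  · have h1 := hLa a ha
    have hbound : ∀ τ : ℝ, 0 ≤ τ → C ^ q * (q * τ) ≤ q * B ^ q * τ := fun τ hτ => by
      nlinarith [mul_le_mul_of_nonneg_right hCB (mul_nonneg hq0.le hτ)]
    set τ := ∑ t, L t / C * ‖a t‖ with hτ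
    have hτ0 : 0 ≤ τ := Finset.sum_nonneg fun t _ =>
      mul_nonneg (div_nonneg (hL0 t) hC0) (norm_nonneg _)
    refine le_trans ?_ (hbound τ hτ0)
    rcases hC0.eq_or_lt with hCz | hCp
    · rw [← hCz, Real.zero_rpow hq0.ne'] at h1 ⊢
      rw [zero_mul]
      linarith [Real.rpow_nonneg (le_max_left 0 (∑ t, (1 - ‖a t‖) * L t)) q]
    have h2 : ∑ t, (1 - ‖a t‖) * L t = C * (1 - τ) := by
      rw [hτ, mul_sub, Finset.mul_sum, mul_one]
      conv_rhs => rw [← hLs]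
      rw [← Finset.sum_sub_distrib]
      refine Finset.sum_congr rfl fun t _ => ?_
      rw [hLs]
      field_simp
    have hτ1 : τ ≤ 1 := by
      have : 0 ≤ C * (1 - τ) := h2 ▸ Finset.sum_nonneg fun t _ =>
        mul_nonneg (by linarith [ha t]) (hL0 t)
      linarith [nonneg_of_mul_nonneg_right this hCp]
    rw [h2, max_eq_right (mul_nonneg hC0 (by linarith)), Real.mul_rpow hC0 (by linarith)] at h1
    -- Bernoulli: `1 - (1 - τ) ^ q ≤ q τ`, the source of the factor `q`.
    have h3 := one_add_mul_self_le_rpow_one_add (s := -τ) (by linarith) hq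
    rw [← sub_eq_add_neg] at h3
    nlinarith [mul_le_mul_of_nonneg_left h3 (Real.rpow_nonneg hC0 q)]

/-! ### From the Lorentz bound to an `L_r(w)` bound -/

/-- Dyadic slicing by size: by Chebyshev the slice `2 ^ n < |a| ≤ 2 ^ (n + 1)` has `w`-mass at most
`2 ^ (-n r)`, so it contributes at most `2 B (2 ^ (1 - r / q)) ^ n`. These terms form a convergent
geometric series when `q < r`. -/
theorem norm_le_of_levels {𝕜 E ι : Type*} [RCLike 𝕜] [NormedAddCommGroup E]
    [NormedSpace 𝕜 E] [Fintype ι] (u : (ι → 𝕜) →ₗ[𝕜] E) {q r B : ℝ} (hq : 0 < q) (hr : 0 < r)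
    (hB : 0 ≤ B) {w : ι → ℝ} (hw : ∀ t, 0 ≤ w t) (hw1 : ∑ t, w t ≤ 1)
    (h : ∀ a : ι → 𝕜, (∀ t, ‖a t‖ ≤ 1) → ‖u a‖ ^ q ≤ B ^ q * ∑ t, w t * ‖a t‖)
    (n : ℕ) (a : ι → 𝕜) (ha : ∀ t, ‖a t‖ ≤ 2 ^ n) (har : ∑ t, w t * ‖a t‖ ^ r ≤ 1) :
    ‖u a‖ ≤ B * (1 + 2 * ∑ k ∈ Finset.range n, ((2 : ℝ) ^ (1 - r / q)) ^ k) := by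
  classical
  induction n generalizing a with
  | zero =>
    have ha' : ∀ t, ‖a t‖ ≤ 1 := fun t => by simpa using ha t
    have h1 : ∑ t, w t * ‖a t‖ ≤ 1 :=
      (Finset.sum_le_sum fun t _ => mul_le_of_le_one_right (hw t) (ha' t)).trans hw1
    have h2 : ‖u a‖ ^ q ≤ B ^ q :=
      (h a ha').trans (mul_le_of_le_one_right (by positivity) h1)
    simpa using (Real.rpow_le_rpow_iff (norm_nonneg _) hB hq).1 h2
  | succ n ih =>
    let b : ι → 𝕜 := fun t => if ‖a t‖ ≤ 2 ^ n then a t else 0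
    let c : ι → 𝕜 := fun t => if ‖a t‖ ≤ 2 ^ n then 0 else (2 ^ (n + 1) : 𝕜)⁻¹ * a t
    have hab : a = b + (2 ^ (n + 1) : 𝕜) • c := by
      ext t
      by_cases ht : ‖a t‖ ≤ 2 ^ n <;> simp [b, c, ht]
    have hb : ‖u b‖ ≤ B * (1 + 2 * ∑ k ∈ Finset.range n, ((2 : ℝ) ^ (1 - r / q)) ^ k) := by
      refine ih b (fun t => ?_) (le_trans (Finset.sum_le_sum fun t _ => ?_) har)
      · by_cases ht : ‖a t‖ ≤ 2 ^ n <;> simp [b, ht]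
      · refine mul_le_mul_of_nonneg_left ?_ (hw t)
        by_cases ht : ‖a t‖ ≤ 2 ^ n
        · simp [b, ht]
        · simp only [b, ht, if_false, norm_zero, Real.zero_rpow hr.ne']
          positivity
    have hc1 : ∀ t, ‖c t‖ ≤ 1 := fun t => by
      by_cases ht : ‖a t‖ ≤ 2 ^ n
      · simp [c, ht]
      · simp only [c, ht, if_false, norm_mul, norm_inv, norm_pow, RCLike.norm_ofNat]
        rw [inv_mul_le_iff₀ (by positivity), mul_one]
        exact ha t
    have hcr : ∀ t, ‖c t‖ ≤ ((2 : ℝ) ^ n) ^ (-r) * ‖a t‖ ^ r := fun t => by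
      by_cases ht : ‖a t‖ ≤ 2 ^ n
      · simp only [c, ht, if_true, norm_zero]
        positivity
      · refine (hc1 t).trans ?_
        rw [Real.rpow_neg (by positivity), ← div_eq_inv_mul, one_le_div (by positivity)]
        exact Real.rpow_le_rpow (by positivity) (not_le.1 ht).le hr.le
    have hcs : ∑ t, w t * ‖c t‖ ≤ ((2 : ℝ) ^ n) ^ (-r) := by
      calc ∑ t, w t * ‖c t‖ ≤ ∑ t, ((2 : ℝ) ^ n) ^ (-r) * (w t * ‖a t‖ ^ r) :=
            Finset.sum_le_sum fun t _ => by
              rw [mul_left_comm]; exact mul_le_mul_of_nonneg_left (hcr t) (hw t)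
        _ ≤ _ := by
            rw [← Finset.mul_sum]
            exact mul_le_of_le_one_right (by positivity) har
    have hc : ‖u c‖ ≤ B * ((2 : ℝ) ^ n) ^ (-(r / q)) := by
      rw [← Real.rpow_le_rpow_iff (norm_nonneg _) (by positivity) hq,
        Real.mul_rpow hB (by positivity), ← Real.rpow_mul (by positivity), neg_mul,
        div_mul_cancel₀ _ hq.ne']
      exact (h c hc1).trans (mul_le_mul_of_nonneg_left hcs (by positivity))
    have hpow : (2 : ℝ) ^ (n + 1) * ((2 : ℝ) ^ n) ^ (-(r / q)) = 2 * ((2 : ℝ) ^ (1 - r / q)) ^ n := by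
      rw [sub_eq_add_neg, Real.rpow_add two_pos, Real.rpow_one, mul_pow, pow_succ,
        ← Real.rpow_natCast ((2 : ℝ) ^ (-(r / q))), ← Real.rpow_mul two_pos.le,
        ← Real.rpow_natCast (2 : ℝ) n, ← Real.rpow_mul two_pos.le, mul_comm (n : ℝ)]
      ring
    calc ‖u a‖ ≤ ‖u b‖ + 2 ^ (n + 1) * ‖u c‖ := by
          conv_lhs => rw [hab, map_add, map_smul]
          refine (norm_add_le _ _).trans_eq ?_
          rw [norm_smul, norm_pow, RCLike.norm_ofNat]
      _ ≤ B * (1 + 2 * ∑ k ∈ Finset.range n, ((2 : ℝ) ^ (1 - r / q)) ^ k) +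
          2 ^ (n + 1) * (B * ((2 : ℝ) ^ n) ^ (-(r / q))) := by gcongr
      _ = _ := by
          rw [mul_left_comm, hpow, Finset.sum_range_succ]
          ring

theorem norm_le_of_weights {𝕜 E ι : Type*} [RCLike 𝕜] [NormedAddCommGroup E]
    [NormedSpace 𝕜 E] [Fintype ι] (u : (ι → 𝕜) →ₗ[𝕜] E) {q r B : ℝ} (hq : 0 < q) (hqr : q < r)
    (hB : 0 ≤ B) {w : ι → ℝ} (hw : ∀ t, 0 ≤ w t) (hw1 : ∑ t, w t ≤ 1)
    (h : ∀ a : ι → 𝕜, (∀ t, ‖a t‖ ≤ 1) → ‖u a‖ ^ q ≤ B ^ q * ∑ t, w t * ‖a t‖)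
    (a : ι → 𝕜) {c : ℝ} (hc : 0 < c) (har : ∑ t, w t * ‖a t‖ ^ r ≤ c ^ r) :
    ‖u a‖ ≤ B * (1 + 2 * (1 - (2 : ℝ) ^ (1 - r / q))⁻¹) * c := by
  have hr : 0 < r := hq.trans hqr
  have hnc : ‖(c : 𝕜)⁻¹‖ = c⁻¹ := by simp [abs_of_pos hc]
  obtain ⟨n, hn⟩ := pow_unbounded_of_one_lt ‖(c : 𝕜)⁻¹ • a‖ one_lt_two
  have h1 := norm_le_of_levels u hq hr hB hw hw1 h n ((c : 𝕜)⁻¹ • a)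
    (fun t => (norm_le_pi_norm _ t).trans hn.le) (by
      have : ∀ t, w t * ‖((c : 𝕜)⁻¹ • a) t‖ ^ r = (c ^ r)⁻¹ * (w t * ‖a t‖ ^ r) := fun t => by
        rw [Pi.smul_apply, norm_smul, hnc, Real.mul_rpow (by positivity) (by positivity),
          Real.inv_rpow hc.le]
        ring
      rw [Finset.sum_congr rfl fun t _ => this t, ← Finset.mul_sum,
        inv_mul_le_iff₀ (by positivity), mul_one]
      exact har)
  have hρ : (2 : ℝ) ^ (1 - r / q) < 1 :=
    Real.rpow_lt_one_of_one_lt_of_neg one_lt_two (by linarith [(one_lt_div hq).2 hqr])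
  have hgeom : ∑ k ∈ Finset.range n, ((2 : ℝ) ^ (1 - r / q)) ^ k ≤ (1 - (2 : ℝ) ^ (1 - r / q))⁻¹ := by
    rw [← tsum_geometric_of_lt_one (by positivity) hρ]
    exact (summable_geometric_of_lt_one (by positivity) hρ).sum_le_tsum _
      fun k _ => by positivity
  rw [map_smul, norm_smul, hnc, inv_mul_le_iff₀ hc, mul_comm c] at h1
  exact h1.trans (by gcongr)

/-! ### Cotype and factorization of families -/

theorem norm_sum_smul_le_weakNorm {𝕜 E : Type*} [RCLike 𝕜] [NormedAddCommGroup E]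
    [NormedSpace 𝕜 E] {m : ℕ} (x : Fin m → E) {a : Fin m → 𝕜} (ha : ∀ t, ‖a t‖ ≤ 1) :
    ‖∑ t, a t • x t‖ ≤ weakNorm 𝕜 1 x := by
  obtain ⟨φ, hφ, hφx⟩ := exists_dual_vector'' 𝕜 (∑ t, a t • x t)
  have h1 : ‖∑ t, a t • x t‖ = ‖φ (∑ t, a t • x t)‖ := by rw [hφx]; simp
  have h2 : (∑ j, ‖φ (x j)‖ ^ (1 : ℝ)) ^ (1 / (1 : ℝ)) ≤ weakNorm 𝕜 1 x :=
    le_ciSup (weakNorm_bddAbove 𝕜 le_rfl x) ⟨φ, hφ⟩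
  simp only [Real.rpow_one, div_one] at h2
  rw [h1, map_sum]
  refine (norm_sum_le_of_le _ fun t _ => ?_).trans h2
  rw [map_smul, norm_smul]
  exact mul_le_of_le_one_left (norm_nonneg _) (ha t)

theorem weakNorm_nonneg {𝕜 E : Type*} [RCLike 𝕜] [NormedAddCommGroup E]
    [NormedSpace 𝕜 E] (p : ℝ) {m : ℕ} (x : Fin m → E) : 0 ≤ weakNorm 𝕜 p x :=
  Real.iSup_nonneg fun _ => by positivity

/-- In a space of cotype `q`, the operator on `ℓ_∞^m` given by a finite family is
`(q, 1)`-summing. -/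
theorem sum_norm_rpow_le_of_cotype {𝕜 E : Type*} [RCLike 𝕜] [NormedAddCommGroup E]
    [NormedSpace 𝕜 E] {q C : ℝ} (hq : 0 < q) (hC : 0 ≤ C)
    (h : ∀ (m : ℕ) (x : Fin m → E), (∑ i, ‖x i‖ ^ q) ^ (1 / q) ≤
      C * ((∑ ε : Fin m → ℤˣ, ‖∑ i, ε i • x i‖ ^ (2 : ℝ)) / 2 ^ m) ^ (1 / (2 : ℝ)))
    {m : ℕ} (x : Fin m → E) {n : ℕ} (z : Fin n → Fin m → 𝕜) (hz : ∀ t, ∑ i, ‖z i t‖ ≤ 1) :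
    ∑ i, ‖Fintype.linearCombination 𝕜 x (z i)‖ ^ q ≤ (C * weakNorm 𝕜 1 x) ^ q := by
  have hW := weakNorm_nonneg (𝕜 := 𝕜) 1 x
  have h1 := h n fun i => Fintype.linearCombination 𝕜 x (z i)
  have h2 : ∀ ε : Fin n → ℤˣ,
      ‖∑ i, ε i • Fintype.linearCombination 𝕜 x (z i)‖ ≤ weakNorm 𝕜 1 x := fun ε => by
    have : ∑ i, ε i • Fintype.linearCombination 𝕜 x (z i) =
        ∑ t, (∑ i, ((ε i : ℤ) : 𝕜) * z i t) • x t := by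
      simp only [Fintype.linearCombination_apply, Finset.sum_smul, Finset.smul_sum]
      rw [Finset.sum_comm]
      refine Finset.sum_congr rfl fun t _ => Finset.sum_congr rfl fun i _ => ?_
      rw [mul_smul, Units.smul_def, Int.cast_smul_eq_zsmul]
    rw [this]
    refine norm_sum_smul_le_weakNorm x fun t => (norm_sum_le_of_le _ fun i _ => ?_).trans (hz t)
    rcases Int.units_eq_one_or (ε i) with hi | hi <;> simp [hi]
  have h3 : ((∑ ε : Fin n → ℤˣ, ‖∑ i, ε i • Fintype.linearCombination 𝕜 x (z i)‖ ^ (2 : ℝ)) /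
      2 ^ n) ^ (1 / (2 : ℝ)) ≤ weakNorm 𝕜 1 x := by
    rw [one_div, Real.rpow_inv_le_iff_of_pos (by positivity) hW two_pos,
      div_le_iff₀ (by positivity)]
    calc _ ≤ ∑ ε : Fin n → ℤˣ, weakNorm 𝕜 1 x ^ (2 : ℝ) := Finset.sum_le_sum fun ε _ =>
          Real.rpow_le_rpow (norm_nonneg _) (h2 ε) two_pos.le
      _ = _ := by simp [mul_comm]
  rw [one_div] at h1
  rw [← Real.rpow_inv_le_iff_of_pos (by positivity) (by positivity) hq]
  exact h1.trans (mul_le_mul_of_nonneg_left h3 hC)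

/-- In a space of cotype `q`, a finite family is the product of a family in the unit ball of `ℓ_r`
and a family whose weak `s`-norm is controlled by the weak `1`-norm of the given one, where
`q < r` and `1 / r + 1 / s = 1`. -/
theorem HasCotype.exists_factorization (𝕜 : Type*) {E : Type*} [RCLike 𝕜] [NormedAddCommGroup E]
    [NormedSpace 𝕜 E] {q r s : ℝ} (hE : HasCotype E q) (hq : 1 ≤ q) (hqr : q < r)
    (hsr : s.HolderConjugate r) :
    ∃ K : ℝ, 0 ≤ K ∧ ∀ (m : ℕ) (x : Fin m → E), ∃ (α : Fin m → ℝ) (y : Fin m → E),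
      (∀ j, 0 ≤ α j) ∧ ∑ j, α j ^ r ≤ 1 ∧ (∀ j, x j = (α j : 𝕜) • y j) ∧
      weakNorm 𝕜 s y ≤ K * weakNorm 𝕜 1 x := by
  classical
  obtain ⟨C, hC, hCE⟩ := hE
  have hq0 : 0 < q := by linarith
  have hr0 : 0 < r := by linarith
  have hs0 : 0 < s := hsr.pos
  have hρ : (2 : ℝ) ^ (1 - r / q) < 1 :=
    Real.rpow_lt_one_of_one_lt_of_neg one_lt_two (by linarith [(one_lt_div hq0).2 hqr])
  have hD : 0 ≤ 1 + 2 * (1 - (2 : ℝ) ^ (1 - r / q))⁻¹ := by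
    have := inv_nonneg.2 (sub_nonneg.2 hρ.le)
    linarith
  set D := 1 + 2 * (1 - (2 : ℝ) ^ (1 - r / q))⁻¹
  refine ⟨q ^ (1 / q) * C * D, by positivity, fun m x => ?_⟩
  have hW := weakNorm_nonneg (𝕜 := 𝕜) 1 x
  set W := weakNorm 𝕜 1 x
  let u := Fintype.linearCombination 𝕜 x
  obtain ⟨w, hw, hw1, hwa⟩ := exists_pisier_weights u hq
    fun n z hz => sum_norm_rpow_le_of_cotype hq0 hC hCE x z hz
  have hB : 0 ≤ q ^ (1 / q) * (C * W) := by positivity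
  have hBq : (q ^ (1 / q) * (C * W)) ^ q = q * (C * W) ^ q := by
    rw [Real.mul_rpow (by positivity) (by positivity), ← Real.rpow_mul hq0.le,
      one_div_mul_cancel hq0.ne', Real.rpow_one]
  have hu : ∀ (a : Fin m → 𝕜) (c : ℝ), 0 < c → ∑ t, w t * ‖a t‖ ^ r ≤ c ^ r →
      ‖u a‖ ≤ q ^ (1 / q) * (C * W) * D * c := fun a c hc har =>
    norm_le_of_weights u hq0 hqr hB hw hw1 (by rw [hBq]; exact hwa) a hc har
  -- Where the weight vanishes so does `x j`, so dividing by `w j ^ (1 / r)` loses nothing.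
  have hx0 : ∀ j, w j = 0 → x j = 0 := fun j hj => by
    have h1 := hwa (Pi.single j 1) fun t => by
      by_cases ht : t = j
      · subst ht; simp
      · simp [ht]
    have h2 : ∑ t, w t * ‖(Pi.single j (1 : 𝕜) : Fin m → 𝕜) t‖ = 0 :=
      Finset.sum_eq_zero fun t _ => by
        by_cases ht : t = j
        · subst ht; simp [hj]
        · simp [ht]
    rw [h2, mul_zero] at h1
    have h3 : u (Pi.single j 1) = x j := by simp [u, Fintype.linearCombination_apply_single]
    rw [h3] at h1
    by_contra hne
    exact absurd h1 (not_le.2 (Real.rpow_pos_of_pos (norm_pos_iff.2 hne) q))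
  have hwr : ∀ j, (w j ^ (1 / r)) ^ r = w j := fun j => by
    rw [← Real.rpow_mul (hw j), one_div_mul_cancel hr0.ne', Real.rpow_one]
  refine ⟨fun j => w j ^ (1 / r), fun j => ((w j ^ (1 / r) : ℝ) : 𝕜)⁻¹ • x j,
    fun j => Real.rpow_nonneg (hw j) _, by simpa only [hwr] using hw1, fun j => ?_, ?_⟩
  · rcases (hw j).eq_or_lt with hj | hj
    · simp [hx0 j hj.symm]
    · rw [smul_inv_smul₀]
      exact_mod_cast (Real.rpow_pos_of_pos hj _).ne'
  set y : Fin m → E := fun j => ((w j ^ (1 / r) : ℝ) : 𝕜)⁻¹ • x j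
  refine Real.iSup_le (fun φ => ?_) (by positivity)
  obtain ⟨φ, hφ⟩ := φ
  set T := ∑ j, ‖φ (y j)‖ ^ s with hT
  have hT0 : 0 ≤ T := by positivity
  change T ^ (1 / s) ≤ _
  rcases hT0.eq_or_lt with hTz | hTp
  · rw [← hTz, Real.zero_rpow (by positivity)]
    positivity
  -- The extremal sequence in Hölder's inequality: `b j * φ (y j) = |φ (y j)| ^ s = |b j| ^ r`.
  let b : Fin m → 𝕜 := fun j => ((‖φ (y j)‖ ^ (s - 2) : ℝ) : 𝕜) * (starRingEnd 𝕜) (φ (y j))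
  have hb : ∀ j, b j * φ (y j) = ((‖φ (y j)‖ ^ s : ℝ) : 𝕜) := fun j => by
    by_cases h0 : φ (y j) = 0
    · simp [h0, Real.zero_rpow hs0.ne']
    · have h1 : 0 < ‖φ (y j)‖ := norm_pos_iff.2 h0
      simp only [b]
      rw [mul_assoc, RCLike.conj_mul]
      norm_cast
      rw [← Real.rpow_natCast, ← Real.rpow_add h1]
      norm_num
  have hbn : ∀ j, ‖b j‖ ^ r = ‖φ (y j)‖ ^ s := fun j => by
    by_cases h0 : φ (y j) = 0
    · simp [b, h0, Real.zero_rpow hs0.ne', Real.zero_rpow hr0.ne']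
    · have h1 : 0 < ‖φ (y j)‖ := norm_pos_iff.2 h0
      simp only [b, norm_mul, RCLike.norm_ofReal, RCLike.norm_conj]
      rw [abs_of_pos (Real.rpow_pos_of_pos h1 _)]
      nth_rewrite 2 [← Real.rpow_one ‖φ (y j)‖]
      rw [← Real.rpow_add h1, ← Real.rpow_mul h1.le]
      congr 1
      have := hsr.sub_one_mul_conj
      linarith
  -- Since `φ (u (b / α)) = T`, bounding `u (b / α)` gives `T ≲ T ^ (1 / r)`. Only `≤` holds here,
  -- as indices with `w j = 0` drop out.
  have h1 : ∑ j, w j * ‖b j * ((w j ^ (1 / r) : ℝ) : 𝕜)⁻¹‖ ^ r ≤ (T ^ (1 / r)) ^ r := by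
    rw [← Real.rpow_mul hT0, one_div_mul_cancel hr0.ne', Real.rpow_one, hT]
    refine Finset.sum_le_sum fun j _ => ?_
    have hwj := Real.rpow_nonneg (hw j) (1 / r)
    rw [norm_mul, Real.mul_rpow (norm_nonneg _) (norm_nonneg _), hbn, norm_inv,
      RCLike.norm_ofReal, abs_of_nonneg hwj, Real.inv_rpow hwj, hwr, mul_left_comm]
    exact mul_le_of_le_one_right (by positivity) (mul_inv_le_one)
  have h2 := hu _ _ (Real.rpow_pos_of_pos hTp _) h1
  have h3 : φ (u fun j => b j * ((w j ^ (1 / r) : ℝ) : 𝕜)⁻¹) = ((T : ℝ) : 𝕜) := by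
    simp only [u, Fintype.linearCombination_apply, map_sum, hT]
    refine Finset.sum_congr rfl fun j _ => ?_
    rw [mul_smul, map_smul, smul_eq_mul]
    exact hb j
  have h4 : T ≤ q ^ (1 / q) * (C * W) * D * T ^ (1 / r) := by
    refine le_trans ?_ h2
    have := φ.le_of_opNorm_le hφ (u fun j => b j * ((w j ^ (1 / r) : ℝ) : 𝕜)⁻¹)
    rwa [h3, RCLike.norm_ofReal, abs_of_pos hTp, one_mul] at this
  have h5 : T ^ (1 / s) * T ^ (1 / r) = T := by
    rw [← Real.rpow_add hTp, one_div, one_div, hsr.inv_add_inv_eq_one, Real.rpow_one]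
  refine le_of_mul_le_mul_right (a := T ^ (1 / r)) ?_ (Real.rpow_pos_of_pos hTp _)
  rw [h5]
  calc T ≤ _ := h4
    _ = _ := by ring

/-! ### Inclusion by Hölder's inequality -/

theorem mainTheorem5 {𝕜 : Type*} [RCLike 𝕜] {n : ℕ} (hn : 1 ≤ n)
    (E : Fin n → Type*) (F : Type*)
    [∀ k, NormedAddCommGroup (E k)] [∀ k, NormedSpace 𝕜 (E k)] [∀ k, CompleteSpace (E k)]
    [NormedAddCommGroup F] [NormedSpace 𝕜 F] [CompleteSpace F]
    (q : ℝ) (hq : 2 < q) (hE : ∀ k, HasCotype (E k) q)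
    (s : ℝ) (hs : 1 ≤ s) (hsq : s < q / (q - 1)) :
    multipleSumming 𝕜 E F s ⊆ multipleSumming 𝕜 E F 1 := by
  rintro A ⟨C, hC, hA⟩
  -- At `s = 1` there is no finite conjugate exponent, but the claim is trivial.
  rcases hs.eq_or_lt with rfl | hs1
  · exact ⟨C, hC, hA⟩
  have hsr : s.HolderConjugate (s / (s - 1)) := Real.HolderConjugate.conjExponent hs1
  set r := s / (s - 1) with hr
  have hqr : q < r := by
    rw [hr, lt_div_iff₀ (by linarith)]
    rw [lt_div_iff₀ (by linarith)] at hsq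
    nlinarith
  choose K hK hfac using fun k => (hE k).exists_factorization 𝕜 (by linarith) hqr hsr
  refine ⟨C * ∏ k, K k, mul_nonneg hC (Finset.prod_nonneg fun k _ => hK k), fun m x => ?_⟩
  choose α y hα hα1 hxy hy using fun k => hfac k (m k) (x k)
  have hAx : ∀ j : ∀ k, Fin (m k), ‖A fun k => x k (j k)‖ =
      ‖A fun k => y k (j k)‖ * ∏ k, α k (j k) := fun j => by
    simp only [hxy]
    rw [A.map_smul_univ, norm_smul, norm_prod, mul_comm]
    simp only [RCLike.norm_ofReal, abs_of_nonneg (hα _ _)]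
  -- The `ℓ_r` sum of a tensor product is the product of the `ℓ_r` sums.
  have hprod : ∑ j : ∀ k, Fin (m k), (∏ k, α k (j k)) ^ r ≤ 1 := by
    have h1 : ∀ j : ∀ k, Fin (m k), (∏ k, α k (j k)) ^ r = ∏ k, α k (j k) ^ r := fun j =>
      (Real.finsetProd_rpow _ _ (fun k _ => hα k (j k)) r).symm
    simp only [h1]
    rw [← Fintype.piFinset_univ,
      ← Finset.prod_univ_sum (fun _ => Finset.univ) fun k j => α k j ^ r]
    exact Finset.prod_le_one (fun k _ => Finset.sum_nonneg fun j _ =>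
      Real.rpow_nonneg (hα k j) r) fun k _ => hα1 k
  simp only [Real.rpow_one, div_one, hAx]
  calc ∑ j : ∀ k, Fin (m k), ‖A fun k => y k (j k)‖ * ∏ k, α k (j k)
      ≤ (∑ j : ∀ k, Fin (m k), ‖A fun k => y k (j k)‖ ^ s) ^ (1 / s) *
        (∑ j : ∀ k, Fin (m k), (∏ k, α k (j k)) ^ r) ^ (1 / r) :=
        Real.inner_le_Lp_mul_Lq_of_nonneg _ hsr (fun j _ => norm_nonneg _)
          fun j _ => Finset.prod_nonneg fun k _ => hα k (j k)
    _ ≤ (∑ j : ∀ k, Fin (m k), ‖A fun k => y k (j k)‖ ^ s) ^ (1 / s) :=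
        mul_le_of_le_one_right (by positivity) (Real.rpow_le_one
          (Finset.sum_nonneg fun j _ => Real.rpow_nonneg
            (Finset.prod_nonneg fun k _ => hα k (j k)) r) hprod (by positivity))
    _ ≤ C * ∏ k, weakNorm 𝕜 s (y k) := hA m y
    _ ≤ C * ∏ k, (K k * weakNorm 𝕜 1 (x k)) := by
        refine mul_le_mul_of_nonneg_left (Finset.prod_le_prod
          (fun k _ => weakNorm_nonneg s (y k)) fun k _ => hy k) hC
    _ = _ := by rw [Finset.prod_mul_distrib, mul_assoc]
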